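/- Let $\mathcal G=(V,E,W)$ be a finite connected weighted graph: $W_{ij}=W_{ji}\ge 0$, $W_{ii}=0$, with $\{i,j\}\in E$ if and only if $W_{ij}>0$. For $\beta\in\mathbb R^V$ let $H_\beta$ be the $V\times V$ matrix with diagonal entries $2\beta_i$ and off-diagonal entries $-W_{ij}$. The $H^{2|2}$-model on $\mathcal G$ is given by a random potential $\beta$ with law $$\nu^{W}(d\beta)=\Big(\sqrt{\tfrac{2}{\pi}}\Big)^{|V|}\mathbf 1_{\{H_\beta>0\}}\,e^{-\frac12\langle 1,H_\beta 1\rangle}\,\frac{1}{\sqrt{\det H_\beta}}\prod_{i\in V}d\beta_i ,$$ and its random Green matrix is $G=H_\beta^{-1}$. Let $\emptyset\ne U\subset V$ be indistinguishable from outside, i.e. $W_{ki}=W_{kj}$ for all $i,j\in U$ and $k\notin U$. The reduced graph $\mathcal G'$ has vertex set $V'=(V\setminus U)\cup\{u\}$ with one new vertex $u$, and weights $W'_{kl}=W_{kl}$ for $k,l\ne u$, $W'_{ku}=W'_{uk}=\sum_{i\in U}W_{ki}$ for $k\neq u$, and $W'_{uu}=0$. Then, conditionally on the random Green matrix $G'$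 of the $H^{2|2}$-model on $\mathcal G'$, one can sample the random Green matrix $G$ of the $H^{2|2}$-model on $\mathcal G$ by injecting independent randomness. Precisely, there is a measurable map $\Phi:\mathbb R^{V'\times V'}\times[0,1]\to\mathbb R^{V\times V}$ such that, whenever $G'$ is a random matrix (on any probability space) with the law of the Green matrix of the $H^{2|2}$-model on $\mathcal G'$, and $\xi$ is uniform on $[0,1]$ and independent of $G'$, the random matrix $G=\Phi(G',\xi)$ has the law of the Green matrix of the $H^{2|2}$-model on $\mathcal G$. Moreover $\Phi$ can be chosen so that this inverts coarse-graining: almost surely $$G'(k,l)=G(k,l),\quad G'(k,u)=G'(u,k)=\frac1{|U|}\sum_{i\in U}G(k,i),\quad G'(u,u)=\frac1{|U|^2}\sum_{i,j\in U}G(i,j)$$ for all $k,l\in V\setminus U$. In particular $G(k,l)=G'(k,l)$ for all $k,l\notin U$. -/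

import Mathlib

open MeasureTheory ProbabilityTheory

/-- Edge weights of a finite simple unoriented weighted graph with vertex set `V`.
The weight `0` encodes the absence of an edge. -/
structure WeightedGraph (V : Type*) where
  weight : V → V → ℝ
  symm : ∀ i j, weight i j = weight j i
  nonneg : ∀ i j, 0 ≤ weight i j
  loopless : ∀ i, weight i i = 0

/-- The entrywise (product) sigma-algebra on matrices. -/
instance Matrix.instMeasurableSpaceEntries {m n α : Type*} [MeasurableSpace α] :
    MeasurableSpace (Matrix m n α) :=
  inferInstanceAs (MeasurableSpace (m → n → α))

namespace WeightedGraph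

section

variable {V : Type*}

/-- The underlying simple graph: the edges are the pairs of positive weight. -/
def toSimpleGraph (𝒢 : WeightedGraph V) : SimpleGraph V where
  Adj i j := 0 < 𝒢.weight i j
  symm := ⟨fun i j h => by rw [𝒢.symm j i]; exact h⟩
  loopless := ⟨fun i h => by rw [𝒢.loopless i] at h; exact lt_irrefl _ h⟩

/-- `U` is indistinguishable from outside: each vertex outside `U` is connected to all the
vertices of `U` with the same weight. -/
def Indistinguishable (𝒢 : WeightedGraph V) (U : Finset V) : Prop :=
  ∀ i ∈ U, ∀ j ∈ U, ∀ k, k ∉ U → 𝒢.weight k i = 𝒢.weight k j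

end

/-- The vertex set `(V \ U) ∪ {u}` of the reduced graph: `none` is the new vertex `u`. -/
abbrev ReducedVertex {V : Type*} (U : Finset V) : Type _ := Option {k : V // k ∉ U}

/-- The reduced graph: `U` is replaced by the single vertex `u = none`, and the weight between
`u` and `k ∉ U` is the sum of the weights between `k` and the vertices of `U`. -/
def reduced {V : Type*} (𝒢 : WeightedGraph V) (U : Finset V) :
    WeightedGraph (ReducedVertex U) where
  weight
    | some k, some l => 𝒢.weight k l
    | some k, none => ∑ i ∈ U, 𝒢.weight k i
    | none, some l => ∑ i ∈ U, 𝒢.weight l i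
    | none, none => 0
  symm := by
    rintro (_ | k) (_ | l)
    · rfl
    · rfl
    · rfl
    · exact 𝒢.symm _ _
  nonneg := by
    rintro (_ | k) (_ | l)
    · exact le_refl _
    · exact Finset.sum_nonneg fun i _ => 𝒢.nonneg _ _
    · exact Finset.sum_nonneg fun i _ => 𝒢.nonneg _ _
    · exact 𝒢.nonneg _ _
  loopless := by
    rintro (_ | k)
    · rfl
    · exact 𝒢.loopless _

noncomputable section

variable {V : Type*} [Fintype V] [DecidableEq V]

/-- The Schrödinger matrix `H_β`: diagonal entries `2 β_i`, off-diagonal entries `-W_{ij}`. -/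
def schrodinger (𝒢 : WeightedGraph V) (β : V → ℝ) : Matrix V V ℝ :=
  Matrix.of fun i j => if i = j then 2 * β i else -𝒢.weight i j

open Classical in
/-- The density of the random potential of the `H^{2|2}`-model on `𝒢`:
`(√(2/π))^{|V|} 1_{H_β > 0} exp (-⟨1, H_β 1⟩ / 2) / √(det H_β)`. -/
def potentialDensity (𝒢 : WeightedGraph V) (β : V → ℝ) : ℝ :=
  if (𝒢.schrodinger β).PosDef then
    Real.sqrt (2 / Real.pi) ^ Fintype.card V
      * Real.exp (-(1 / 2) * ((fun _ => 1) ⬝ᵥ (𝒢.schrodinger β).mulVec (fun _ => 1)))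
      / Real.sqrt (𝒢.schrodinger β).det
  else 0

/-- The law `ν^W` of the random potential `β` of the `H^{2|2}`-model on `𝒢`. -/
def potentialLaw (𝒢 : WeightedGraph V) : Measure (V → ℝ) :=
  (volume : Measure (V → ℝ)).withDensity fun β => ENNReal.ofReal (𝒢.potentialDensity β)

/-- The Green matrix `G = H_β⁻¹`. -/
def green (𝒢 : WeightedGraph V) (β : V → ℝ) : Matrix V V ℝ := (𝒢.schrodinger β)⁻¹

/-- The law of the random Green matrix of the `H^{2|2}`-model on `𝒢`. -/
def greenLaw (𝒢 : WeightedGraph V) : Measure (Matrix V V ℝ) :=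
  𝒢.potentialLaw.map 𝒢.green

/-- The Green matrix depends measurably on the potential, so `greenLaw` is a genuine
push-forward. -/
theorem measurable_green (𝒢 : WeightedGraph V) : Measurable 𝒢.green := by
  have hc : Continuous 𝒢.schrodinger := by
    refine continuous_matrix fun i j => ?_
    by_cases h : i = j
    · simp only [schrodinger, Matrix.of_apply, h, if_true]; fun_prop
    · simp only [schrodinger, Matrix.of_apply, h, if_false]; fun_prop
  refine measurable_pi_lambda _ fun i => measurable_pi_lambda _ fun j => ?_
  have : (fun β => 𝒢.green β i j) =
      fun β => ((𝒢.schrodinger β).det)⁻¹ * (𝒢.schrodinger β).adjugate i j := by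
    funext β
    simp [green, Matrix.inv_def]
  rw [this]
  exact hc.matrix_det.measurable.inv.mul ((hc.matrix_adjugate.matrix_elem i j).measurable)

end

/-- Coarse-graining of a matrix on `V` into a matrix on `(V \ U) ∪ {u}`, by averaging over the
indices in `U`. -/
noncomputable def coarseGrain {V : Type*} (U : Finset V) (G : Matrix V V ℝ) :
    Matrix (ReducedVertex U) (ReducedVertex U) ℝ :=
  Matrix.of fun
    | some k, some l => G k l
    | some k, none => (U.card : ℝ)⁻¹ * ∑ i ∈ U, G k i
    | none, some l => (U.card : ℝ)⁻¹ * ∑ i ∈ U, G i l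
    | none, none => ((U.card : ℝ) ^ 2)⁻¹ * ∑ i ∈ U, ∑ j ∈ U, G i j

end WeightedGraph

section InverseGaussianIntegral

open Real Filter Set Topology

/-- The error function without its normalisation. -/
noncomputable def gaussPrimitive (x : ℝ) : ℝ := ∫ t in (0 : ℝ)..x, exp (-1 * t ^ 2)

theorem hasDerivAt_gaussPrimitive (x : ℝ) :
    HasDerivAt gaussPrimitive (exp (-1 * x ^ 2)) x := by
  have hc : Continuous fun t : ℝ => exp (-1 * t ^ 2) := by fun_prop
  exact intervalIntegral.integral_hasDerivAt_right (hc.intervalIntegrable _ _)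
    (hc.stronglyMeasurableAtFilter _ _) hc.continuousAt

theorem tendsto_gaussPrimitive_atTop : Tendsto gaussPrimitive atTop (𝓝 (√π / 2)) := by
  have h := intervalIntegral_tendsto_integral_Ioi (0 : ℝ)
    (integrable_exp_neg_mul_sq (one_pos)).integrableOn tendsto_id
  rw [integral_gaussian_Ioi, div_one] at h
  exact h

theorem tendsto_gaussPrimitive_atBot : Tendsto gaussPrimitive atBot (𝓝 (-(√π / 2))) := by
  have hodd : ∀ x, gaussPrimitive x = -gaussPrimitive (-x) := by
    intro x
    have h := intervalIntegral.integral_comp_neg (a := 0) (b := x)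
      fun t : ℝ => exp (-1 * t ^ 2)
    simp only [neg_sq, neg_zero] at h
    rw [gaussPrimitive, gaussPrimitive, h, intervalIntegral.integral_symm]
  have h := (tendsto_gaussPrimitive_atTop.comp tendsto_neg_atBot_atTop).neg
  exact h.congr fun x => (hodd x).symm

/-- The density of the Gamma law of shape `1 / 2`, the one-vertex potential law. -/
noncomputable def gammaHalfDensity (y : ℝ) : ℝ :=
  if 0 < y then exp (-y) / √(π * y) else 0

theorem gammaHalfDensity_nonneg (y : ℝ) : 0 ≤ gammaHalfDensity y := by
  unfold gammaHalfDensity; split_ifs <;> positivity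

theorem measurable_gammaHalfDensity : Measurable gammaHalfDensity :=
  Measurable.ite measurableSet_Ioi (by fun_prop) measurable_const

theorem hasDerivAt_inverseGaussian_primitive (c : ℝ) {y : ℝ} (hy : 0 < y) :
    HasDerivAt (fun y => exp c * gaussPrimitive (√y + c / 2 / √y)
      + exp (-c) * gaussPrimitive (√y - c / 2 / √y)) (exp (-y) / √y * exp (-(c ^ 2 / (4 * y)))) y := by
  have hs : 0 < √y := sqrt_pos.2 hy
  have hsq : √y ^ 2 = y := sq_sqrt hy.le
  have h1 : HasDerivAt (fun y => √y) (1 / (2 * √y)) y := (hasDerivAt_id y).sqrt hy.ne'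
  have h2 : HasDerivAt (fun y => c / 2 / √y) (-(c / 2 * (1 / (2 * √y))) / √y ^ 2) y := by
    have := (hasDerivAt_const y (c / 2)).div h1 hs.ne'
    simpa using! this
  have h3 := ((hasDerivAt_gaussPrimitive _).comp y (h1.add h2)).const_mul (exp c)
  have h4 := ((hasDerivAt_gaussPrimitive _).comp y (h1.sub h2)).const_mul (exp (-c))
  refine (h3.add h4).congr_deriv ?_
  have e1 : exp c * exp (-1 * (√y + c / 2 / √y) ^ 2) = exp (-y) * exp (-(c ^ 2 / (4 * y))) := by
    rw [← exp_add, ← exp_add]; congr 1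
    generalize √y = r at hs hsq
    subst hsq
    field_simp
    ring
  have e2 : exp (-c) * exp (-1 * (√y - c / 2 / √y) ^ 2) = exp (-y) * exp (-(c ^ 2 / (4 * y))) := by
    rw [← exp_add, ← exp_add]; congr 1
    generalize √y = r at hs hsq
    subst hsq
    field_simp
    ring
  simp only [Pi.add_apply, Pi.sub_apply]
  rw [← mul_assoc, ← mul_assoc, e1, e2]
  field_simp
  ring

theorem tendsto_inverseGaussian_primitive_zero {c : ℝ} (hc : 0 ≤ c) :
    Tendsto (fun y => exp c * gaussPrimitive (√y + c / 2 / √y)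
      + exp (-c) * gaussPrimitive (√y - c / 2 / √y)) (𝓝[>] 0)
      (𝓝 (exp c * (√π / 2) - exp (-c) * (√π / 2))) := by
  have hs : Tendsto (fun y : ℝ => √y) (𝓝[>] 0) (𝓝[>] 0) := by
    refine tendsto_nhdsWithin_iff.2 ⟨?_, ?_⟩
    · have := (continuous_sqrt.tendsto 0).mono_left (nhdsWithin_le_nhds (s := Ioi 0))
      simpa using this
    · filter_upwards [self_mem_nhdsWithin] with y hy using sqrt_pos.2 hy
  rcases hc.eq_or_lt with rfl | hc
  · have h0 : Tendsto (fun y : ℝ => gaussPrimitive √y) (𝓝[>] 0) (𝓝 0) := by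
      have h := (hasDerivAt_gaussPrimitive 0).continuousAt.tendsto
      have e : gaussPrimitive 0 = 0 := by simp [gaussPrimitive]
      rw [e] at h
      exact h.comp (hs.mono_right nhdsWithin_le_nhds)
    simpa using h0.add h0
  · have hi : Tendsto (fun y : ℝ => c / 2 / √y) (𝓝[>] 0) atTop := by
      simp_rw [div_eq_mul_inv (c / 2)]
      exact Tendsto.const_mul_atTop (by positivity) (tendsto_inv_nhdsGT_zero.comp hs)
    have hs' := hs.mono_right nhdsWithin_le_nhds
    have h1 := tendsto_gaussPrimitive_atTop.comp (hs'.add_atTop hi)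
    have h2 := tendsto_gaussPrimitive_atBot.comp (hs'.add_atBot (tendsto_neg_atTop_atBot.comp hi))
    have h := (h1.const_mul (exp c)).add (h2.const_mul (exp (-c)))
    rw [mul_neg, ← sub_eq_add_neg] at h
    exact h

theorem tendsto_inverseGaussian_primitive_atTop (c : ℝ) :
    Tendsto (fun y => exp c * gaussPrimitive (√y + c / 2 / √y)
      + exp (-c) * gaussPrimitive (√y - c / 2 / √y)) atTop
      (𝓝 (exp c * (√π / 2) + exp (-c) * (√π / 2))) := by
  have hi : Tendsto (fun y : ℝ => c / 2 / √y) atTop (𝓝 0) :=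
    tendsto_const_nhds.div_atTop tendsto_sqrt_atTop
  have h1 := tendsto_gaussPrimitive_atTop.comp (tendsto_sqrt_atTop.atTop_add hi)
  have h2 := tendsto_gaussPrimitive_atTop.comp (tendsto_sqrt_atTop.atTop_add hi.neg)
  exact (h1.const_mul (exp c)).add (h2.const_mul (exp (-c)))

theorem lintegral_inverseGaussian {c : ℝ} (hc : 0 ≤ c) :
    ∫⁻ y in Ioi 0, ENNReal.ofReal (exp (-y) / √y * exp (-(c ^ 2 / (4 * y))))
      = ENNReal.ofReal (√π * exp (-c)) := by
  set f : ℝ → ℝ := fun y => exp c * gaussPrimitive (√y + c / 2 / √y)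
      + exp (-c) * gaussPrimitive (√y - c / 2 / √y) with hf
  set g : ℝ → ℝ := Function.update f 0 (exp c * (√π / 2) - exp (-c) * (√π / 2)) with hg
  have hfg : ∀ y ≠ 0, g y = f y := fun y hy => Function.update_of_ne hy _ _
  have hcont : ContinuousWithinAt g (Ici 0) 0 := by
    rw [← continuousWithinAt_Ioi_iff_Ici, ContinuousWithinAt, hg, Function.update_self]
    refine (tendsto_inverseGaussian_primitive_zero hc).congr' ?_
    filter_upwards [self_mem_nhdsWithin] with y hy
    exact (hfg y (ne_of_gt hy)).symm
  have hderiv : ∀ y ∈ Ioi (0 : ℝ),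
      HasDerivAt g (exp (-y) / √y * exp (-(c ^ 2 / (4 * y)))) y := by
    intro y hy
    refine (hasDerivAt_inverseGaussian_primitive c hy).congr_of_eventuallyEq ?_
    filter_upwards [Ioi_mem_nhds hy] with z hz using hfg z (ne_of_gt hz)
  have hnn : ∀ y ∈ Ioi (0 : ℝ), 0 ≤ exp (-y) / √y * exp (-(c ^ 2 / (4 * y))) :=
    fun y _ => by positivity
  have hlim : Tendsto g atTop (𝓝 (exp c * (√π / 2) + exp (-c) * (√π / 2))) := by
    refine (tendsto_inverseGaussian_primitive_atTop c).congr' ?_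
    filter_upwards [eventually_gt_atTop 0] with y hy using (hfg y (ne_of_gt hy)).symm
  have hint := integrableOn_Ioi_deriv_of_nonneg hcont hderiv hnn hlim
  rw [← ofReal_integral_eq_lintegral_ofReal hint
    ((ae_restrict_iff' measurableSet_Ioi).2 (ae_of_all _ hnn)),
    integral_Ioi_of_hasDerivAt_of_nonneg hcont hderiv hnn hlim, hg, Function.update_self]
  congr 1
  ring

theorem lintegral_gammaHalfDensity {c : ℝ} (hc : 0 ≤ c) :
    ∫⁻ y, ENNReal.ofReal (gammaHalfDensity y * exp (-(c ^ 2 / (4 * y))))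
      = ENNReal.ofReal (exp (-c)) := by
  have hπ : 0 < √π := sqrt_pos.2 pi_pos
  have h : ∀ y, ENNReal.ofReal (gammaHalfDensity y * exp (-(c ^ 2 / (4 * y))))
      = (Ioi 0).indicator (fun y => ENNReal.ofReal (√π)⁻¹ *
        ENNReal.ofReal (exp (-y) / √y * exp (-(c ^ 2 / (4 * y))))) y := by
    intro y
    by_cases hy : 0 < y
    · rw [indicator_of_mem (mem_Ioi.2 hy), ← ENNReal.ofReal_mul (by positivity), gammaHalfDensity,
        if_pos hy, sqrt_mul pi_pos.le]
      congr 1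
      field_simp
    · rw [indicator_of_notMem (by simpa using hy), gammaHalfDensity, if_neg hy]
      simp
  simp_rw [h]
  rw [lintegral_indicator measurableSet_Ioi, lintegral_const_mul _ (by fun_prop),
    lintegral_inverseGaussian hc, ← ENNReal.ofReal_mul (by positivity)]
  congr 1
  field_simp

end InverseGaussianIntegral

namespace Matrix

variable {m n : Type*} [Fintype m] [Fintype n] [DecidableEq m] [DecidableEq n]

theorem posDef_submatrix_equiv {M : Matrix n n ℝ} (e : m ≃ n) :
    (M.submatrix e e).PosDef ↔ M.PosDef := by
  constructor
  · intro h
    rw [(posSemidef_submatrix_equiv e).1 h.posSemidef |>.posDef_iff_det_ne_zero,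
      ← det_submatrix_equiv_self e]
    exact h.det_pos.ne'
  · intro h
    rw [((posSemidef_submatrix_equiv e).2 h.posSemidef).posDef_iff_det_ne_zero,
      det_submatrix_equiv_self e]
    exact h.det_pos.ne'

theorem posDef_fromBlocks_iff {A : Matrix m m ℝ} {B : Matrix m n ℝ} {D : Matrix n n ℝ} :
    (fromBlocks A B Bᵀ D).PosDef ↔ A.PosDef ∧ (D - Bᵀ * A⁻¹ * B).PosDef := by
  have key : A.PosDef →
      ((fromBlocks A B Bᵀ D).PosDef ↔ (D - Bᵀ * A⁻¹ * B).PosDef) := by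
    intro hA
    have := hA.isUnit.invertible
    have h := PosDef.fromBlocks₁₁ B D hA
    rw [conjTranspose_eq_transpose_of_trivial] at h
    have hdet : (fromBlocks A B Bᵀ D).det = A.det * (D - Bᵀ * A⁻¹ * B).det := by
      rw [det_fromBlocks₁₁, invOf_eq_nonsing_inv]
    constructor
    · intro hM
      rw [(h.1 hM.posSemidef).posDef_iff_det_ne_zero]
      exact right_ne_zero_of_mul (hdet ▸ hM.det_pos.ne')
    · intro hS
      rw [(h.2 hS.posSemidef).posDef_iff_det_ne_zero, hdet]
      exact mul_ne_zero hA.det_pos.ne' hS.det_pos.ne'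
  refine ⟨fun hM => ?_, fun h => (key h.1).2 h.2⟩
  have hA : A.PosDef := by
    refine posDef_iff_dotProduct_mulVec.2 ⟨?_, fun x hx => ?_⟩
    · have := hM.1
      rw [isHermitian_fromBlocks_iff] at this
      exact this.1
    · have h0 : Sum.elim x (0 : n → ℝ) ≠ 0 := by
        intro h; apply hx; funext i; simpa using congrFun h (Sum.inl i)
      have := hM.dotProduct_mulVec_pos h0
      simpa [fromBlocks_mulVec, dotProduct, Matrix.mulVec_zero] using this
  exact ⟨hA, (key hA).1 hM⟩

/-- The inverse of a positive definite matrix with nonpositive off-diagonal entries is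
entrywise nonnegative. -/
theorem PosDef.inv_mulVec_nonneg {K : Matrix n n ℝ} (hK : K.PosDef)
    (hoff : ∀ i j, i ≠ j → K i j ≤ 0) {η : n → ℝ} (hη : ∀ i, 0 ≤ η i) (i : n) :
    0 ≤ (K⁻¹ *ᵥ η) i := by
  set x := K⁻¹ *ᵥ η with hx
  have hKx : K *ᵥ x = η := by
    rw [hx, mulVec_mulVec, mul_nonsing_inv _ (isUnit_iff_ne_zero.2 hK.det_pos.ne'), one_mulVec]
  set z : n → ℝ := fun i => max (-x i) 0 with hz
  have hz0 : ∀ i, 0 ≤ z i := fun i => le_max_right _ _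
  by_contra! hi
  have hzne : z ≠ 0 := by
    intro h
    have := congrFun h i
    simp only [hz, Pi.zero_apply, max_eq_right_iff] at this
    linarith
  have h1 := hK.dotProduct_mulVec_pos hzne
  have h2 : 0 ≤ z ⬝ᵥ η := Finset.sum_nonneg fun i _ => mul_nonneg (hz0 i) (hη i)
  have h3 : z ⬝ᵥ K *ᵥ (x + z) ≤ 0 := by
    refine Finset.sum_nonpos fun i _ => ?_
    rw [mulVec, dotProduct, Finset.mul_sum]
    refine Finset.sum_nonpos fun j _ => ?_
    have hp : 0 ≤ (x + z) j := by
      simp only [hz, Pi.add_apply]; linarith [le_max_left (-x j) 0]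
    by_cases hij : i = j
    · subst hij
      have : z i * (x + z) i = 0 := by
        simp only [hz, Pi.add_apply]
        rcases le_total (-x i) 0 with h | h
        · simp [max_eq_right h]
        · simp [max_eq_left h]
      rw [mul_left_comm, this, mul_zero]
    · exact mul_nonpos_of_nonneg_of_nonpos (hz0 i)
        (mul_nonpos_of_nonpos_of_nonneg (hoff i j hij) hp)
  rw [mulVec_add, dotProduct_add, hKx] at h3
  simp only [star_trivial] at h1
  linarith

end Matrix

namespace Matrix

variable {m n : Type*} [Fintype m] [Fintype n] [DecidableEq m] [DecidableEq n]

theorem dotProduct_inv_fromBlocks_mulVec {A : Matrix m m ℝ} {B : Matrix m n ℝ} {D : Matrix n n ℝ}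
    (hA : A.PosDef) (hS : (D - Bᵀ * A⁻¹ * B).PosDef) (x : m → ℝ) (y : n → ℝ) :
    Sum.elim x y ⬝ᵥ (fromBlocks A B Bᵀ D)⁻¹ *ᵥ Sum.elim x y
      = x ⬝ᵥ A⁻¹ *ᵥ x
        + (y - Bᵀ *ᵥ A⁻¹ *ᵥ x) ⬝ᵥ (D - Bᵀ * A⁻¹ * B)⁻¹ *ᵥ (y - Bᵀ *ᵥ A⁻¹ *ᵥ x) := by
  set S := D - Bᵀ * A⁻¹ * B with hSdef
  have hAu : IsUnit A.det := isUnit_iff_ne_zero.2 hA.det_pos.ne'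
  have hSu : IsUnit S.det := isUnit_iff_ne_zero.2 hS.det_pos.ne'
  have hMu : IsUnit (fromBlocks A B Bᵀ D).det :=
    isUnit_iff_ne_zero.2 (posDef_fromBlocks_iff.2 ⟨hA, hS⟩).det_pos.ne'
  set r := y - Bᵀ *ᵥ A⁻¹ *ᵥ x with hr
  set v := S⁻¹ *ᵥ r with hv
  set u := A⁻¹ *ᵥ (x - B *ᵥ v) with hu
  have hSv : S *ᵥ v = r := by rw [hv, mulVec_mulVec, mul_nonsing_inv _ hSu, one_mulVec]
  have hAv : A *ᵥ u = x - B *ᵥ v := by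
    rw [hu, mulVec_mulVec, mul_nonsing_inv _ hAu, one_mulVec]
  have hM : fromBlocks A B Bᵀ D *ᵥ Sum.elim u v = Sum.elim x y := by
    rw [fromBlocks_mulVec]
    congr 1
    · simp only [Sum.elim_comp_inl, Sum.elim_comp_inr]
      rw [hAv, sub_add_cancel]
    · simp only [Sum.elim_comp_inl, Sum.elim_comp_inr]
      rw [hu, mulVec_sub, mulVec_sub]
      have : D *ᵥ v = r + Bᵀ *ᵥ A⁻¹ *ᵥ B *ᵥ v := by
        rw [← hSv, hSdef, sub_mulVec]
        simp only [mulVec_mulVec, sub_add_cancel, Matrix.mul_assoc]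
      rw [this, hr]
      abel
  have hinv : (fromBlocks A B Bᵀ D)⁻¹ *ᵥ Sum.elim x y = Sum.elim u v := by
    rw [← hM, mulVec_mulVec, nonsing_inv_mul _ hMu, one_mulVec]
  rw [hinv, sumElim_dotProduct_sumElim, hu, mulVec_sub, dotProduct_sub, hr, sub_dotProduct]
  have hsymm : x ⬝ᵥ A⁻¹ *ᵥ B *ᵥ v = Bᵀ *ᵥ A⁻¹ *ᵥ x ⬝ᵥ v := by
    have hAt : A⁻¹ᵀ = A⁻¹ := by
      have := hA.inv.1
      rwa [IsHermitian, conjTranspose_eq_transpose_of_trivial] at this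
    rw [dotProduct_mulVec, ← mulVec_transpose, hAt, dotProduct_mulVec, ← mulVec_transpose]
  rw [hsymm]
  ring

end Matrix

theorem MeasureTheory.lintegral_pi_eq_lintegral_prod_of_equiv_sum {ι α β : Type*} [Fintype ι]
    [Fintype α] [Fintype β] (e : α ⊕ β ≃ ι) (f : (ι → ℝ) → ENNReal) :
    ∫⁻ x, f x = ∫⁻ p : (α → ℝ) × (β → ℝ), f (Sum.elim p.1 p.2 ∘ e.symm) := by
  have h1 := (volume_measurePreserving_piCongrLeft (fun _ : ι => ℝ) e).lintegral_comp_emb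
    (MeasurableEquiv.measurableEmbedding _) f
  have h2 := (volume_measurePreserving_sumPiEquivProdPi_symm
    (fun _ : α ⊕ β => ℝ)).lintegral_comp_emb (MeasurableEquiv.measurableEmbedding _)
    fun x => f (MeasurableEquiv.piCongrLeft (fun _ : ι => ℝ) e x)
  rw [← h1, ← h2]
  refine lintegral_congr fun p => congrArg f (funext fun i => ?_)
  obtain ⟨j, rfl⟩ := e.surjective i
  rw [MeasurableEquiv.coe_piCongrLeft, Equiv.piCongrLeft_apply_apply]
  cases j <;> simp [MeasurableEquiv.coe_sumPiEquivProdPi_symm, Equiv.sumPiEquivProdPi]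

theorem measurable_sumElim_comp_symm {ι α β : Type*} (e : α ⊕ β ≃ ι) :
    Measurable fun p : (α → ℝ) × (β → ℝ) => Sum.elim p.1 p.2 ∘ e.symm := by
  refine measurable_pi_lambda _ fun i => ?_
  obtain ⟨j | j, rfl⟩ := e.surjective i
  · simpa using! (measurable_pi_apply j).comp measurable_fst
  · simpa using! (measurable_pi_apply j).comp measurable_snd

namespace WeightedGraph

/-- The pull-back of the weights along a map of vertex sets. -/
def comap {κ ι : Type*} (𝒢 : WeightedGraph ι) (f : κ → ι) : WeightedGraph κ where
  weight i j := 𝒢.weight (f i) (f j)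
  symm _ _ := 𝒢.symm _ _
  nonneg _ _ := 𝒢.nonneg _ _
  loopless _ := 𝒢.loopless _

noncomputable section

open Matrix

variable {ι α β : Type*} [DecidableEq ι] [DecidableEq α] [DecidableEq β]

theorem continuous_schrodinger (𝒢 : WeightedGraph ι) : Continuous 𝒢.schrodinger := by
  refine continuous_matrix fun i j => ?_
  by_cases h : i = j
  · simp only [schrodinger, Matrix.of_apply, h, if_true]; fun_prop
  · simp only [schrodinger, Matrix.of_apply, h, if_false]; fun_prop

theorem isHermitian_schrodinger (𝒢 : WeightedGraph ι) (x : ι → ℝ) :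
    (𝒢.schrodinger x).IsHermitian := by
  ext i j
  by_cases h : i = j
  · subst h; simp
  · simp [schrodinger, h, Ne.symm h, 𝒢.symm i j]

/-- The off-diagonal block of the Schrödinger matrix between two parts of the vertex set. -/
def crossBlock (𝒢 : WeightedGraph ι) (e : α ⊕ β ≃ ι) : Matrix α β ℝ :=
  of fun i j => -𝒢.weight (e (.inl i)) (e (.inr j))

theorem schrodinger_submatrix_eq_fromBlocks (𝒢 : WeightedGraph ι) (e : α ⊕ β ≃ ι)
    (a : α → ℝ) (b : β → ℝ) :
    (𝒢.schrodinger (Sum.elim a b ∘ e.symm)).submatrix e e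
      = fromBlocks ((𝒢.comap (e ∘ Sum.inl)).schrodinger a) (𝒢.crossBlock e) (𝒢.crossBlock e)ᵀ
        ((𝒢.comap (e ∘ Sum.inr)).schrodinger b) := by
  ext (i | i) (j | j)
  · simp [schrodinger, comap]
  · simp [schrodinger, crossBlock]
  · simp [schrodinger, crossBlock, 𝒢.symm (e (.inr i))]
  · simp [schrodinger, comap]

variable [Fintype ι] [Fintype α] [Fintype β]

theorem measurableSet_posDef_schrodinger (𝒢 : WeightedGraph ι) :
    MeasurableSet {x | (𝒢.schrodinger x).PosDef} := by
  have h : {x | (𝒢.schrodinger x).PosDef} = {x | (𝒢.schrodinger x).PosSemidef}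
      ∩ {x | (𝒢.schrodinger x).det ≠ 0} := by
    ext x
    exact ⟨fun h => ⟨h.posSemidef, h.det_pos.ne'⟩, fun h => h.1.posDef_iff_det_ne_zero.2 h.2⟩
  rw [h]
  refine MeasurableSet.inter (IsClosed.measurableSet ?_)
    ((measurableSet_singleton 0).compl.preimage 𝒢.continuous_schrodinger.matrix_det.measurable)
  have h' : {x | (𝒢.schrodinger x).PosSemidef}
      = ⋂ v : ι → ℝ, {x | 0 ≤ v ⬝ᵥ 𝒢.schrodinger x *ᵥ v} := by
    ext x
    simp only [posSemidef_iff_dotProduct_mulVec, isHermitian_schrodinger, true_and, star_trivial,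
      Set.mem_ofPred_eq, Set.mem_iInter]
  rw [h']
  refine isClosed_iInter fun v => isClosed_le continuous_const ?_
  exact continuous_const.dotProduct (𝒢.continuous_schrodinger.matrix_mulVec continuous_const)

theorem measurable_potentialDensity (𝒢 : WeightedGraph ι) : Measurable 𝒢.potentialDensity := by
  refine Measurable.ite 𝒢.measurableSet_posDef_schrodinger ?_ measurable_const
  have h1 : Continuous fun x => (fun _ : ι => (1 : ℝ)) ⬝ᵥ 𝒢.schrodinger x *ᵥ fun _ => 1 :=
    continuous_const.dotProduct (𝒢.continuous_schrodinger.matrix_mulVec continuous_const)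
  have h2 := 𝒢.continuous_schrodinger.matrix_det
  exact (((h1.const_mul _).rexp.const_mul _).measurable).div h2.sqrt.measurable

theorem potentialDensity_nonneg (𝒢 : WeightedGraph ι) (x : ι → ℝ) : 0 ≤ 𝒢.potentialDensity x := by
  unfold potentialDensity; split_ifs <;> positivity

theorem one_dotProduct_schrodinger_mulVec_one (𝒢 : WeightedGraph ι) (x : ι → ℝ) :
    (fun _ => 1) ⬝ᵥ 𝒢.schrodinger x *ᵥ (fun _ => 1)
      = ∑ i, 2 * x i - ∑ i, ∑ j, 𝒢.weight i j := by
  have h : ∀ i j, 𝒢.schrodinger x i j = (if i = j then 2 * x i else 0) - 𝒢.weight i j := by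
    intro i j
    by_cases h : i = j
    · subst h; simp [schrodinger, 𝒢.loopless]
    · simp [schrodinger, h]
  simp [dotProduct, mulVec, h, Finset.sum_sub_distrib]

/-- The Schur complement of the first block of the Schrödinger matrix. -/
def schur (𝒢 : WeightedGraph ι) (e : α ⊕ β ≃ ι) (a : α → ℝ) (b : β → ℝ) : Matrix β β ℝ :=
  (𝒢.comap (e ∘ Sum.inr)).schrodinger b
    - (𝒢.crossBlock e)ᵀ * (𝒢.comap (e ∘ Sum.inl)).green a * 𝒢.crossBlock e

theorem posDef_schrodinger_iff (𝒢 : WeightedGraph ι) (e : α ⊕ β ≃ ι) (a : α → ℝ) (b : β → ℝ) :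
    (𝒢.schrodinger (Sum.elim a b ∘ e.symm)).PosDef
      ↔ ((𝒢.comap (e ∘ Sum.inl)).schrodinger a).PosDef ∧ (𝒢.schur e a b).PosDef := by
  rw [← posDef_submatrix_equiv e, schrodinger_submatrix_eq_fromBlocks, posDef_fromBlocks_iff,
    schur, green]

theorem det_schrodinger_eq (𝒢 : WeightedGraph ι) (e : α ⊕ β ≃ ι) {a : α → ℝ} (b : β → ℝ)
    (ha : ((𝒢.comap (e ∘ Sum.inl)).schrodinger a).PosDef) :
    (𝒢.schrodinger (Sum.elim a b ∘ e.symm)).det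
      = ((𝒢.comap (e ∘ Sum.inl)).schrodinger a).det * (𝒢.schur e a b).det := by
  have := ha.isUnit.invertible
  rw [← det_submatrix_equiv_self e, schrodinger_submatrix_eq_fromBlocks, det_fromBlocks₁₁,
    invOf_eq_nonsing_inv, schur, green]

theorem one_dotProduct_schrodinger_mulVec_one_eq (𝒢 : WeightedGraph ι) (e : α ⊕ β ≃ ι)
    (a : α → ℝ) (b : β → ℝ) :
    (fun _ => 1) ⬝ᵥ 𝒢.schrodinger (Sum.elim a b ∘ e.symm) *ᵥ (fun _ => 1)
      = (fun _ => 1) ⬝ᵥ (𝒢.comap (e ∘ Sum.inl)).schrodinger a *ᵥ (fun _ => 1)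
        + (fun _ => 1) ⬝ᵥ (𝒢.comap (e ∘ Sum.inr)).schrodinger b *ᵥ (fun _ => 1)
        - 2 * ∑ i, ∑ j, 𝒢.weight (e (.inl i)) (e (.inr j)) := by
  simp only [one_dotProduct_schrodinger_mulVec_one, ← e.sum_comp, Fintype.sum_sum_type, comap,
    Function.comp_apply, Equiv.symm_apply_apply, Sum.elim_inl, Sum.elim_inr,
    Finset.sum_add_distrib]
  rw [Finset.sum_comm (f := fun (i : β) (j : α) => 𝒢.weight (e (.inr i)) (e (.inl j)))]
  simp only [𝒢.symm (e (.inr _)) (e (.inl _))]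
  ring

open Classical in
/-- The factor of the potential density on a union of two blocks that remains once the density
of the first block is divided out, in terms of the Schur complement `S`. -/
def schurDensity (𝒢 : WeightedGraph ι) (e : α ⊕ β ≃ ι) (b : β → ℝ) (S : Matrix β β ℝ) : ℝ :=
  if S.PosDef then
    √(2 / Real.pi) ^ Fintype.card β
      * Real.exp (-(1 / 2)
          * ((fun _ => 1) ⬝ᵥ (𝒢.comap (e ∘ Sum.inr)).schrodinger b *ᵥ (fun _ => 1))
        + ∑ i, ∑ j, 𝒢.weight (e (.inl i)) (e (.inr j)))
      / √S.det
  else 0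

theorem potentialDensity_eq_mul_schurDensity (𝒢 : WeightedGraph ι) (e : α ⊕ β ≃ ι)
    (a : α → ℝ) (b : β → ℝ) :
    𝒢.potentialDensity (Sum.elim a b ∘ e.symm)
      = (𝒢.comap (e ∘ Sum.inl)).potentialDensity a * 𝒢.schurDensity e b (𝒢.schur e a b) := by
  unfold potentialDensity schurDensity
  by_cases ha : ((𝒢.comap (e ∘ Sum.inl)).schrodinger a).PosDef
  · by_cases hS : (𝒢.schur e a b).PosDef
    · rw [if_pos ((𝒢.posDef_schrodinger_iff e a b).2 ⟨ha, hS⟩), if_pos ha, if_pos hS,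
        𝒢.det_schrodinger_eq e b ha, one_dotProduct_schrodinger_mulVec_one_eq,
        Real.sqrt_mul ha.det_pos.le, ← Fintype.card_congr e, Fintype.card_sum, pow_add,
        div_mul_div_comm]
      congr 1
      rw [mul_mul_mul_comm, ← Real.exp_add]
      congr 2
      ring
    · rw [if_neg fun h => hS ((𝒢.posDef_schrodinger_iff e a b).1 h).2, if_neg hS, mul_zero]
  · rw [if_neg fun h => ha ((𝒢.posDef_schrodinger_iff e a b).1 h).1, if_neg ha, zero_mul]

theorem dotProduct_green_mulVec_eq (𝒢 : WeightedGraph ι) (e : α ⊕ β ≃ ι) {a : α → ℝ} {b : β → ℝ}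
    (ha : ((𝒢.comap (e ∘ Sum.inl)).schrodinger a).PosDef) (hS : (𝒢.schur e a b).PosDef)
    (η : ι → ℝ) :
    let r := η ∘ e ∘ Sum.inr
      - (𝒢.crossBlock e)ᵀ *ᵥ (𝒢.comap (e ∘ Sum.inl)).green a *ᵥ (η ∘ e ∘ Sum.inl)
    η ⬝ᵥ 𝒢.green (Sum.elim a b ∘ e.symm) *ᵥ η
      = (η ∘ e ∘ Sum.inl) ⬝ᵥ (𝒢.comap (e ∘ Sum.inl)).green a *ᵥ (η ∘ e ∘ Sum.inl)
        + r ⬝ᵥ (𝒢.schur e a b)⁻¹ *ᵥ r := by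
  intro r
  have h := dotProduct_inv_fromBlocks_mulVec ha hS (η ∘ e ∘ Sum.inl) (η ∘ e ∘ Sum.inr)
  rw [← schrodinger_submatrix_eq_fromBlocks, inv_submatrix_equiv] at h
  have he : Sum.elim (η ∘ e ∘ Sum.inl) (η ∘ e ∘ Sum.inr) = η ∘ e := by
    ext (i | i) <;> rfl
  rw [he, submatrix_mulVec_equiv, Function.comp_assoc, Equiv.self_comp_symm, Function.comp_id,
    comp_equiv_dotProduct_comp_equiv] at h
  exact h

end

end WeightedGraph

namespace WeightedGraph

noncomputable section

open Matrix

universe u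

variable {ι : Type u} {α β : Type*} [DecidableEq ι] [DecidableEq α] [DecidableEq β]
  [Fintype ι] [Fintype α] [Fintype β]

theorem _root_.Matrix.posDef_iff_of_unique {u : Type*} [Fintype u] [DecidableEq u] [Unique u]
    {S : Matrix u u ℝ} :
    S.PosDef ↔ 0 < S default default := by
  constructor
  · intro h
    simpa [det_unique] using h.det_pos
  · intro h
    refine posDef_iff_dotProduct_mulVec.2 ⟨?_, fun x hx => ?_⟩
    · ext i j
      simp [Subsingleton.elim i default, Subsingleton.elim j default]
    · have hx' : x default ≠ 0 := fun h0 => hx (funext fun i => by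
        rw [Subsingleton.elim i default, h0, Pi.zero_apply])
      have : 0 < x default * x default := mul_self_pos.2 hx'
      simp only [star_trivial, dotProduct, mulVec, Finset.univ_unique, Finset.sum_singleton]
      nlinarith

theorem isHermitian_green (𝒢 : WeightedGraph ι) (x : ι → ℝ) : (𝒢.green x).IsHermitian :=
  (𝒢.isHermitian_schrodinger x).inv

theorem dotProduct_green_mulVec_comm (𝒢 : WeightedGraph ι) (x u v : ι → ℝ) :
    u ⬝ᵥ 𝒢.green x *ᵥ v = v ⬝ᵥ 𝒢.green x *ᵥ u := by
  have h := 𝒢.isHermitian_green x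
  rw [IsHermitian, conjTranspose_eq_transpose_of_trivial] at h
  rw [dotProduct_mulVec, ← mulVec_transpose, h, dotProduct_comm]

theorem green_mulVec_nonneg (𝒢 : WeightedGraph ι) {x : ι → ℝ} (hx : (𝒢.schrodinger x).PosDef)
    {η : ι → ℝ} (hη : ∀ i, 0 ≤ η i) (i : ι) : 0 ≤ (𝒢.green x *ᵥ η) i := by
  refine hx.inv_mulVec_nonneg (fun i j hij => ?_) hη i
  simpa [schrodinger, hij] using 𝒢.nonneg i j

/-- Integrating out the potential at one vertex. -/
theorem lintegral_potentialDensity_one_vertex (𝒢 : WeightedGraph ι) (e : α ⊕ Unit ≃ ι)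
    {η : ι → ℝ} (hη : ∀ i, 0 ≤ η i) (a : α → ℝ) :
    let w : α → ℝ := fun i => 𝒢.weight (e (.inl i)) (e (.inr ()))
    let ζ : α → ℝ := η ∘ e ∘ Sum.inl + w
    ∫⁻ t : ℝ, ENNReal.ofReal (𝒢.potentialDensity (Sum.elim a (fun _ => t) ∘ e.symm)
        * Real.exp (-(1 / 2) * (η ⬝ᵥ 𝒢.green (Sum.elim a (fun _ => t) ∘ e.symm) *ᵥ η)))
      = ENNReal.ofReal (Real.exp (∑ i, w i - η (e (.inr ()))))
        * ENNReal.ofReal ((𝒢.comap (e ∘ Sum.inl)).potentialDensity a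
          * Real.exp (-(1 / 2) * (ζ ⬝ᵥ (𝒢.comap (e ∘ Sum.inl)).green a *ᵥ ζ))) := by
  intro w ζ
  set 𝒦 := 𝒢.comap (e ∘ Sum.inl) with h𝒦
  by_cases ha : (𝒦.schrodinger a).PosDef
  swap
  · have h1 : ∀ b, 𝒢.potentialDensity (Sum.elim a b ∘ e.symm) = 0 := fun b => by
      rw [potentialDensity_eq_mul_schurDensity, potentialDensity, if_neg ha, zero_mul]
    have h2 : 𝒦.potentialDensity a = 0 := by rw [potentialDensity, if_neg ha]
    simp [h1, h2]
  set η' : α → ℝ := η ∘ e ∘ Sum.inl with hη'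
  set p : ℝ := 1 / 2 * (w ⬝ᵥ 𝒦.green a *ᵥ w) with hp
  set c : ℝ := η (e (.inr ())) + w ⬝ᵥ 𝒦.green a *ᵥ η' with hc
  have hc0 : 0 ≤ c := add_nonneg (hη _) <| Finset.sum_nonneg fun i _ =>
    mul_nonneg (𝒢.nonneg _ _) (𝒦.green_mulVec_nonneg ha (fun j => hη _) i)
  set C : ℝ := 𝒦.potentialDensity a * Real.exp (∑ i, w i - p - 1 / 2 * (η' ⬝ᵥ 𝒦.green a *ᵥ η'))
    with hC
  have hC0 : 0 ≤ C := mul_nonneg (𝒦.potentialDensity_nonneg a) (Real.exp_pos _).le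
  have hB : ∀ i j, 𝒢.crossBlock e i j = -w i := fun i j => rfl
  have hS : ∀ t : ℝ, 𝒢.schur e a (fun _ => t) () () = 2 * (t - p) := by
    intro t
    have h : ((𝒢.crossBlock e)ᵀ * 𝒦.green a * 𝒢.crossBlock e) () () = w ⬝ᵥ 𝒦.green a *ᵥ w := by
      rw [Matrix.mul_assoc]
      simp [mul_apply, hB, dotProduct, mulVec]
    rw [schur, Matrix.sub_apply, h, hp]
    simp only [schrodinger, of_apply, if_true]
    ring
  have hpt : ∀ t : ℝ, 𝒢.potentialDensity (Sum.elim a (fun _ => t) ∘ e.symm)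
        * Real.exp (-(1 / 2) * (η ⬝ᵥ 𝒢.green (Sum.elim a (fun _ => t) ∘ e.symm) *ᵥ η))
      = C * (gammaHalfDensity (t - p) * Real.exp (-(c ^ 2 / (4 * (t - p))))) := by
    intro t
    rw [potentialDensity_eq_mul_schurDensity, schurDensity, gammaHalfDensity]
    have hpd : (𝒢.schur e a (fun _ => t)).PosDef ↔ 0 < t - p := by
      rw [posDef_iff_of_unique]
      change 0 < 𝒢.schur e a (fun _ => t) () () ↔ _
      rw [hS]
      constructor <;> intro h <;> linarith
    by_cases ht : 0 < t - p
    · rw [if_pos (hpd.2 ht), if_pos ht, 𝒢.dotProduct_green_mulVec_eq e ha (hpd.2 ht)]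
      have hr : (η ∘ e ∘ Sum.inr - (𝒢.crossBlock e)ᵀ *ᵥ 𝒦.green a *ᵥ (η ∘ e ∘ Sum.inl)) ()
          = c := by
        simp only [Pi.sub_apply, Function.comp_apply, mulVec, dotProduct, transpose_apply, hB,
          neg_mul, Finset.sum_neg_distrib, sub_neg_eq_add, hc, hη']
      have hq : ∀ r : Unit → ℝ, r () = c →
          r ⬝ᵥ (𝒢.schur e a (fun _ => t))⁻¹ *ᵥ r = c ^ 2 / (2 * (t - p)) := by
        intro r hr
        have hi : (𝒢.schur e a (fun _ => t))⁻¹ () () = (2 * (t - p))⁻¹ := by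
          rw [← hS t, inv_def, det_unique, adjugate_subsingleton]
          simp
        simp only [dotProduct, mulVec, Finset.univ_unique, Finset.sum_singleton,
          PUnit.default_eq_unit, hi, hr]
        field_simp
      rw [hq _ hr, one_dotProduct_schrodinger_mulVec_one]
      have hdet : (𝒢.schur e a (fun _ => t)).det = 2 * (t - p) := by
        rw [det_unique]; exact hS t
      have hw0 : (𝒢.comap (e ∘ Sum.inr)).weight () () = 0 := loopless _ _
      simp only [hdet, Finset.univ_unique, Finset.sum_singleton, PUnit.default_eq_unit, hw0,
        Fintype.card_unique, pow_one, sub_zero]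
      have hsq : √(2 / Real.pi) / √(2 * (t - p)) = 1 / √(Real.pi * (t - p)) := by
        rw [← Real.sqrt_div (by positivity), ← Real.sqrt_one, ← Real.sqrt_div (by positivity)]
        congr 1
        field_simp
      have hexp : Real.exp (-(1 / 2) * (2 * t) + ∑ i, w i)
            * Real.exp (-(1 / 2) * (η' ⬝ᵥ 𝒦.green a *ᵥ η' + c ^ 2 / (2 * (t - p))))
          = Real.exp (∑ i, w i - p - 1 / 2 * (η' ⬝ᵥ 𝒦.green a *ᵥ η')) * (Real.exp (-(t - p))
            * Real.exp (-(c ^ 2 / (4 * (t - p))))) := by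
        simp only [← Real.exp_add]
        congr 1
        field_simp
        ring
      calc _ = 𝒦.potentialDensity a * (√(2 / Real.pi) / √(2 * (t - p)))
            * (Real.exp (-(1 / 2) * (2 * t) + ∑ i, w i)
            * Real.exp (-(1 / 2) * (η' ⬝ᵥ 𝒦.green a *ᵥ η' + c ^ 2 / (2 * (t - p))))) := by ring
        _ = _ := by rw [hsq, hexp, hC]; ring
    · rw [if_neg (hpd.not.2 ht), if_neg ht]
      simp
  simp_rw [hpt, ENNReal.ofReal_mul hC0]
  rw [lintegral_const_mul' _ _ ENNReal.ofReal_ne_top,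
    lintegral_sub_right_eq_self
      (fun y => ENNReal.ofReal (gammaHalfDensity y * Real.exp (-(c ^ 2 / (4 * y))))) p,
    lintegral_gammaHalfDensity hc0, ← ENNReal.ofReal_mul hC0,
    ← ENNReal.ofReal_mul (Real.exp_pos _).le]
  congr 1
  rw [hC, mul_assoc, ← Real.exp_add, mul_left_comm, ← Real.exp_add]
  congr 2
  change _ = _ + -(1 / 2) * ((η' + w) ⬝ᵥ 𝒦.green a *ᵥ (η' + w))
  rw [mulVec_add, add_dotProduct, dotProduct_add, dotProduct_add,
    𝒦.dotProduct_green_mulVec_comm a η' w, hc, hp]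
  ring

theorem measurable_dotProduct_green_mulVec (𝒢 : WeightedGraph ι) (η : ι → ℝ) :
    Measurable fun x => η ⬝ᵥ 𝒢.green x *ᵥ η := by
  have h := fun i j => (measurable_pi_apply j).comp ((measurable_pi_apply i).comp 𝒢.measurable_green)
  refine Finset.measurable_sum _ fun i _ => Measurable.const_mul ?_ _
  exact Finset.measurable_sum _ fun j _ => (h i j).mul_const _

/-- The Laplace transform of the quadratic form of the Green matrix in a nonnegative vector. -/
theorem lintegral_potentialDensity_mul_exp (𝒢 : WeightedGraph ι) {η : ι → ℝ}
    (hη : ∀ i, 0 ≤ η i) :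
    ∫⁻ x, ENNReal.ofReal (𝒢.potentialDensity x
        * Real.exp (-(1 / 2) * (η ⬝ᵥ 𝒢.green x *ᵥ η)))
      = ENNReal.ofReal (Real.exp (-∑ i, η i)) := by
  induction hn : Fintype.card ι generalizing ι with
  | zero =>
    have := Fintype.card_eq_zero_iff.1 hn
    have hpd : ∀ x, (𝒢.schrodinger x).PosDef := fun x =>
      posDef_iff_dotProduct_mulVec.2 ⟨𝒢.isHermitian_schrodinger x,
        fun y hy => absurd (Subsingleton.elim y 0) hy⟩
    rw [volume_pi, Measure.pi_of_empty _ (isEmptyElim : ι → ℝ), lintegral_dirac]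
    simp [potentialDensity, hpd]
  | succ n ih =>
    have e : ULift.{u} (Fin n) ⊕ Unit ≃ ι := Fintype.equivOfCardEq (by simp [hn])
    have hm : Measurable fun x : ι → ℝ => ENNReal.ofReal (𝒢.potentialDensity x
        * Real.exp (-(1 / 2) * (η ⬝ᵥ 𝒢.green x *ᵥ η))) :=
      (𝒢.measurable_potentialDensity.mul
        ((𝒢.measurable_dotProduct_green_mulVec η).const_mul _).exp).ennreal_ofReal
    have hj := measurable_sumElim_comp_symm e
    rw [lintegral_pi_eq_lintegral_prod_of_equiv_sum e, Measure.volume_eq_prod,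
      lintegral_prod (fun p : (ULift.{u} (Fin n) → ℝ) × (Unit → ℝ) =>
        ENNReal.ofReal (𝒢.potentialDensity (Sum.elim p.1 p.2 ∘ e.symm) * Real.exp (-(1 / 2)
          * (η ⬝ᵥ 𝒢.green (Sum.elim p.1 p.2 ∘ e.symm) *ᵥ η)))) (hm.comp hj).aemeasurable]
    have hstep := 𝒢.lintegral_potentialDensity_one_vertex e hη
    have hu : ∀ a : ULift.{u} (Fin n) → ℝ, ∀ f : (ι → ℝ) → ENNReal,
        ∫⁻ b : Unit → ℝ, f (Sum.elim a b ∘ e.symm)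
          = ∫⁻ t : ℝ, f (Sum.elim a (fun _ => t) ∘ e.symm) := fun a f =>
      ((volume_preserving_funUnique Unit ℝ).symm.lintegral_comp_emb
        (MeasurableEquiv.measurableEmbedding _) fun b => f (Sum.elim a b ∘ e.symm)).symm
    simp only at hstep ⊢
    rw [lintegral_congr fun a => (hu a fun x => ENNReal.ofReal (𝒢.potentialDensity x
        * Real.exp (-(1 / 2) * (η ⬝ᵥ 𝒢.green x *ᵥ η)))).trans (hstep a),
      lintegral_const_mul' _ _ ENNReal.ofReal_ne_top,
      ih (𝒢.comap (e ∘ Sum.inl))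
        (η := η ∘ e ∘ Sum.inl + fun i => 𝒢.weight (e (.inl i)) (e (.inr ())))
        (fun i => add_nonneg (hη _) (𝒢.nonneg _ _)) (by simp),
      ← ENNReal.ofReal_mul (Real.exp_pos _).le, ← Real.exp_add, ← e.sum_comp]
    congr 2
    simp [Finset.sum_add_distrib]
    ring

instance isProbabilityMeasure_potentialLaw (𝒢 : WeightedGraph ι) :
    IsProbabilityMeasure 𝒢.potentialLaw := by
  constructor
  have h := 𝒢.lintegral_potentialDensity_mul_exp (η := 0) fun _ => le_rfl
  rw [potentialLaw, withDensity_apply _ MeasurableSet.univ, Measure.restrict_univ]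
  simpa using h

instance isProbabilityMeasure_greenLaw (𝒢 : WeightedGraph ι) :
    IsProbabilityMeasure 𝒢.greenLaw :=
  Measure.isProbabilityMeasure_map 𝒢.measurable_green.aemeasurable

end

end WeightedGraph

open scoped NNReal BoundedContinuousFunction in
/-- A finite measure on the nonnegative reals is determined by its Laplace transform at the
natural numbers. -/
theorem MeasureTheory.Measure.ext_of_lintegral_exp_neg_nat_mul {μ ν : Measure ℝ≥0}
    [IsFiniteMeasure μ] [IsFiniteMeasure ν]
    (h : ∀ k : ℕ, ∫⁻ x : ℝ≥0, ENNReal.ofReal (Real.exp (-(k * x))) ∂μ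
      = ∫⁻ x : ℝ≥0, ENNReal.ofReal (Real.exp (-(k * x))) ∂ν) : μ = ν := by
  let f : ℝ≥0 →ᵇ ℝ := BoundedContinuousFunction.ofNormedAddCommGroup
    (fun x : ℝ≥0 => Real.exp (-x)) (by fun_prop) 1 fun x => by
      rw [Real.norm_eq_abs, Real.abs_exp]
      exact Real.exp_le_one_iff.2 (neg_nonpos.2 x.2)
  have hf : ∀ x, f x = Real.exp (-x) := fun _ => rfl
  have hstar : ∀ a : ℝ≥0 →ᵇ ℝ, star a = a := fun a => by ext x; simp
  let A : StarSubalgebra ℝ (ℝ≥0 →ᵇ ℝ) :=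
    { Algebra.adjoin ℝ {f} with star_mem' := fun {a} ha => (hstar a).symm ▸ ha }
  have hfA : f ∈ A := Algebra.self_mem_adjoin_singleton ℝ f
  refine ext_of_forall_mem_subalgebra_integral_eq_of_polish (𝕜 := ℝ) (A := A) ?_ fun g hg => ?_
  · intro x y hxy
    refine ⟨f, ⟨_, ⟨f, hfA, rfl⟩, rfl⟩, ?_⟩
    rw [hf, hf]
    intro he
    exact hxy (NNReal.eq (neg_injective (Real.exp_injective he)))
  · have hg' : g ∈ Algebra.adjoin ℝ {f} := hg
    rw [Algebra.adjoin_singleton_eq_range_aeval] at hg'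
    obtain ⟨p, rfl⟩ := hg'
    have hpow : ∀ k : ℕ, ∀ x, (f ^ k) x = Real.exp (-(k * x)) := fun k x => by
      rw [BoundedContinuousFunction.pow_apply, hf, ← Real.exp_nat_mul, mul_neg]
    have hk : ∀ k : ℕ, ∫ x, (f ^ k) x ∂μ = ∫ x, (f ^ k) x ∂ν := by
      intro k
      simp_rw [hpow]
      rw [integral_eq_lintegral_of_nonneg_ae (ae_of_all _ fun x => (Real.exp_pos _).le)
        (by fun_prop), h k, ← integral_eq_lintegral_of_nonneg_ae
        (ae_of_all _ fun x => (Real.exp_pos _).le) (by fun_prop)]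
    clear hg
    change ∫ x, (Polynomial.aeval f p) x ∂μ = ∫ x, (Polynomial.aeval f p) x ∂ν
    induction p using Polynomial.induction_on' with
    | add p q hp hq =>
      have hi := fun (m : Measure ℝ≥0) (_ : IsFiniteMeasure m) (g : ℝ≥0 →ᵇ ℝ) => g.integrable m
      simp only [map_add] at hp hq ⊢
      simp only [BoundedContinuousFunction.coe_add, Pi.add_apply]
      rw [integral_add (hi _ ‹_› _) (hi _ ‹_› _), integral_add (hi _ ‹_› _) (hi _ ‹_› _), hp, hq]
    | monomial k c =>
      have : ∀ x, (Polynomial.aeval f (Polynomial.monomial k c)) x = c * (f ^ k) x := fun x => by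
        rw [Polynomial.aeval_monomial, ← Algebra.smul_def, BoundedContinuousFunction.coe_smul]
        rfl
      simp_rw [this, integral_const_mul, hk]

namespace WeightedGraph

noncomputable section

open Matrix

variable {α : Type*} [DecidableEq α] [Fintype α]

theorem lintegral_potentialLaw (𝒢 : WeightedGraph α) {f : (α → ℝ) → ENNReal}
    (hf : Measurable f) :
    ∫⁻ a, f a ∂𝒢.potentialLaw = ∫⁻ a, ENNReal.ofReal (𝒢.potentialDensity a) * f a :=
  lintegral_withDensity_eq_lintegral_mul _ 𝒢.measurable_potentialDensity.ennreal_ofReal hf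

theorem ae_posDef_potentialLaw (𝒢 : WeightedGraph α) :
    ∀ᵐ a ∂𝒢.potentialLaw, (𝒢.schrodinger a).PosDef := by
  rw [potentialLaw, ae_withDensity_iff 𝒢.measurable_potentialDensity.ennreal_ofReal]
  refine ae_of_all _ fun a ha => ?_
  by_contra hn
  exact ha (by rw [potentialDensity, if_neg hn, ENNReal.ofReal_zero])

/-- The sum of the entries of the Green matrix. -/
def greenSum (𝒢 : WeightedGraph α) (a : α → ℝ) : ℝ :=
  (fun _ => 1) ⬝ᵥ 𝒢.green a *ᵥ (fun _ => 1)

theorem measurable_greenSum (𝒢 : WeightedGraph α) : Measurable 𝒢.greenSum :=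
  𝒢.measurable_dotProduct_green_mulVec _

theorem greenSum_pos [Nonempty α] (𝒢 : WeightedGraph α) {a : α → ℝ}
    (ha : (𝒢.schrodinger a).PosDef) : 0 < 𝒢.greenSum a := by
  have h := ha.inv.dotProduct_mulVec_pos (x := fun _ => 1)
    fun h => one_ne_zero (congrFun h (Classical.arbitrary α))
  simpa [greenSum, green] using h

/-- The law of `|α|² / (2 ⟨1, G 1⟩)` is the one-vertex potential law. -/
theorem lintegral_potentialLaw_comp_greenSum [Nonempty α] (𝒢 : WeightedGraph α)
    {F : ℝ → ENNReal} (hF : Measurable F) :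
    ∫⁻ a, F ((Fintype.card α : ℝ) ^ 2 / (2 * 𝒢.greenSum a)) ∂𝒢.potentialLaw
      = ∫⁻ y, ENNReal.ofReal (gammaHalfDensity y) * F y := by
  set n : ℝ := (Fintype.card α : ℝ) with hn
  have hn0 : 0 < n := Nat.cast_pos.2 Fintype.card_pos
  set γ : Measure ℝ := volume.withDensity fun y => ENNReal.ofReal (gammaHalfDensity y) with hγ
  have hγm : Measurable fun y => ENNReal.ofReal (gammaHalfDensity y) :=
    measurable_gammaHalfDensity.ennreal_ofReal
  have hγpos : ∀ᵐ y ∂γ, 0 < y := by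
    rw [hγ, ae_withDensity_iff hγm]
    refine ae_of_all _ fun y hy => ?_
    by_contra hn
    exact hy (by rw [gammaHalfDensity, if_neg hn, ENNReal.ofReal_zero])
  have hγlap : ∀ c : ℝ, 0 ≤ c → ∫⁻ y, ENNReal.ofReal (Real.exp (-(c ^ 2 / (4 * y)))) ∂γ
      = ENNReal.ofReal (Real.exp (-c)) := by
    intro c hc
    rw [hγ, lintegral_withDensity_eq_lintegral_mul _ hγm (by fun_prop),
      ← lintegral_gammaHalfDensity hc]
    exact lintegral_congr fun y => (ENNReal.ofReal_mul (gammaHalfDensity_nonneg y)).symm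
  have : IsFiniteMeasure γ := by
    constructor
    have h := hγlap 0 le_rfl
    simp only [ne_eq, OfNat.ofNat_ne_zero, not_false_eq_true, zero_pow, zero_div, neg_zero,
      Real.exp_zero, ENNReal.ofReal_one, lintegral_const, one_mul] at h
    rw [h]
    exact ENNReal.one_lt_top
  have hm1 : Measurable fun a => (𝒢.greenSum a).toNNReal := 𝒢.measurable_greenSum.real_toNNReal
  have hm2 : Measurable fun y : ℝ => (n ^ 2 / (2 * y)).toNNReal := by fun_prop
  have hlaw : 𝒢.potentialLaw.map (fun a => (𝒢.greenSum a).toNNReal)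
      = γ.map fun y => (n ^ 2 / (2 * y)).toNNReal := by
    have hem : ∀ k : ℕ,
        Measurable fun x : NNReal => ENNReal.ofReal (Real.exp (-((k : ℝ) * x))) := by
      intro k; fun_prop
    refine Measure.ext_of_lintegral_exp_neg_nat_mul fun k => ?_
    rw [lintegral_map (hem k) hm1, lintegral_map (hem k) hm2]
    have hk : √(2 * k) ^ 2 = 2 * (k : ℝ) := Real.sq_sqrt (by positivity)
    trans ENNReal.ofReal (Real.exp (-(n * √(2 * k))))
    · have h := 𝒢.lintegral_potentialDensity_mul_exp (η := fun _ => √(2 * k))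
        fun _ => Real.sqrt_nonneg _
      rw [Finset.sum_const, nsmul_eq_mul, Finset.card_univ] at h
      have hem' : Measurable fun a => ENNReal.ofReal (Real.exp (-(k * 𝒢.greenSum a))) :=
        (𝒢.measurable_greenSum.const_mul (k : ℝ)).neg.exp.ennreal_ofReal
      rw [← h, lintegral_congr_ae (g := fun a =>
        ENNReal.ofReal (Real.exp (-(k * 𝒢.greenSum a)))), lintegral_potentialLaw _ hem']
      · refine lintegral_congr fun a => ?_
        rw [← ENNReal.ofReal_mul (𝒢.potentialDensity_nonneg a)]
        congr 3
        have hv : (fun _ : α => √(2 * (k : ℝ))) = √(2 * k) • fun _ => (1 : ℝ) := by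
          ext; simp
        rw [hv, mulVec_smul, smul_dotProduct, dotProduct_smul, smul_smul, ← pow_two, hk,
          smul_eq_mul, greenSum]
        ring
      · filter_upwards [𝒢.ae_posDef_potentialLaw] with a ha
        rw [Real.coe_toNNReal _ (𝒢.greenSum_pos ha).le]
    · rw [← hγlap _ (by positivity)]
      refine lintegral_congr_ae ?_
      filter_upwards [hγpos] with y hy
      rw [Real.coe_toNNReal _ (by positivity), mul_pow, hk]
      congr 3
      field_simp
      ring
  have hG : Measurable fun x : NNReal => F (n ^ 2 / (2 * (x : ℝ))) := hF.comp (by fun_prop)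
  have h1 := lintegral_map (μ := 𝒢.potentialLaw) hG hm1
  rw [hlaw, lintegral_map hG hm2] at h1
  have h2 := lintegral_withDensity_eq_lintegral_mul volume hγm hF
  simp only [Pi.mul_apply] at h2
  rw [← h2]
  trans ∫⁻ a, F (n ^ 2 / (2 * ((𝒢.greenSum a).toNNReal : ℝ))) ∂𝒢.potentialLaw
  · refine lintegral_congr_ae ?_
    filter_upwards [𝒢.ae_posDef_potentialLaw] with a ha
    rw [Real.coe_toNNReal _ (𝒢.greenSum_pos ha).le]
  · rw [← h1]
    refine lintegral_congr_ae ?_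
    filter_upwards [hγpos] with y hy
    rw [Real.coe_toNNReal _ (by positivity)]
    congr 1
    field_simp

end

end WeightedGraph

namespace WeightedGraph

noncomputable section

open Matrix

theorem potentialDensity_unit (𝒢 : WeightedGraph Unit) (x : Unit → ℝ) :
    𝒢.potentialDensity x = gammaHalfDensity (x ()) := by
  have hx : 𝒢.schrodinger x () () = 2 * x () := by simp [schrodinger]
  have hpd : (𝒢.schrodinger x).PosDef ↔ 0 < x () := by
    rw [posDef_iff_of_unique]
    change 0 < 𝒢.schrodinger x () () ↔ _
    rw [hx]
    constructor <;> intro h <;> linarith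
  rw [potentialDensity, gammaHalfDensity]
  by_cases h : 0 < x ()
  · have hdet : (𝒢.schrodinger x).det = 2 * x () := by
      rw [det_unique]; exact hx
    have hsq : √(2 / Real.pi) / √(2 * x ()) = 1 / √(Real.pi * x ()) := by
      rw [← Real.sqrt_div (by positivity), ← Real.sqrt_one, ← Real.sqrt_div (by positivity)]
      congr 1
      field_simp
    rw [if_pos (hpd.2 h), if_pos h, one_dotProduct_schrodinger_mulVec_one, hdet]
    simp only [Finset.univ_unique, Finset.sum_singleton, PUnit.default_eq_unit, 𝒢.loopless,
      Fintype.card_unique, pow_one, sub_zero]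
    rw [mul_div_right_comm, hsq, show -(1 / 2) * (2 * x ()) = -x () by ring]
    ring
  · rw [if_neg (hpd.not.2 h), if_neg h]

theorem green_unit (𝒢 : WeightedGraph Unit) (x : Unit → ℝ) : 𝒢.green x () () = (2 * x ())⁻¹ := by
  have hx : 𝒢.schrodinger x () () = 2 * x () := by simp [schrodinger]
  rw [← hx, green, inv_def, det_unique, adjugate_subsingleton]
  simp

variable {V : Type*} [DecidableEq V]

/-- A vertex set is split into `U` and its complement. -/
def splitEquiv (U : Finset V) : {i // i ∈ U} ⊕ {i // i ∉ U} ≃ V := Equiv.sumCompl (· ∈ U)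

/-- The reduced vertex set is split into the new vertex and the complement of `U`. -/
def reducedSplitEquiv (U : Finset V) : Unit ⊕ {i // i ∉ U} ≃ ReducedVertex U :=
  ((Equiv.optionEquivSumPUnit _).trans (Equiv.sumComm _ _)).symm

/-- The graph induced on `U`. -/
abbrev inside (𝒢 : WeightedGraph V) (U : Finset V) : WeightedGraph {i // i ∈ U} :=
  𝒢.comap (splitEquiv U ∘ Sum.inl)

/-- The potential on the new vertex of the reduced graph in terms of the potential on `U`. -/
def reducedPotential (𝒢 : WeightedGraph V) (U : Finset V) (a : {i // i ∈ U} → ℝ) : ℝ :=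
  (U.card : ℝ) ^ 2 / (2 * (𝒢.inside U).greenSum a)

section Blocks

variable {𝒢 : WeightedGraph V} {U : Finset V}

omit [DecidableEq V] in
theorem Indistinguishable.exists_weight (hind : 𝒢.Indistinguishable U) (hU : U.Nonempty) :
    ∃ w : {i // i ∉ U} → ℝ, ∀ k : {i // i ∉ U}, ∀ i ∈ U, 𝒢.weight k i = w k := by
  obtain ⟨u, hu⟩ := hU
  exact ⟨fun k => 𝒢.weight k u, fun k i hi => hind i hi u hu k k.2⟩

theorem greenSum_inside_pos {a : {i // i ∈ U} → ℝ} (ha : ((𝒢.inside U).schrodinger a).PosDef)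
    (hU : U.Nonempty) : 0 < (𝒢.inside U).greenSum a := by
  have := hU.to_subtype
  exact (𝒢.inside U).greenSum_pos ha

theorem reducedPotential_pos {a : {i // i ∈ U} → ℝ} (ha : ((𝒢.inside U).schrodinger a).PosDef)
    (hU : U.Nonempty) : 0 < 𝒢.reducedPotential U a := by
  have := greenSum_inside_pos ha hU
  have := hU.card_pos
  unfold reducedPotential
  positivity

variable {w : {i // i ∉ U} → ℝ} (hw : ∀ k : {i // i ∉ U}, ∀ i ∈ U, 𝒢.weight k i = w k)

include hw

theorem crossBlock_splitEquiv (i : {i // i ∈ U}) (k : {i // i ∉ U}) :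
    𝒢.crossBlock (splitEquiv U) i k = -w k := by
  rw [← hw k i i.2, 𝒢.symm]
  rfl

omit [DecidableEq V] in
theorem crossBlock_reducedSplitEquiv (i : Unit) (k : {i // i ∉ U}) :
    (𝒢.reduced U).crossBlock (reducedSplitEquiv U) i k = -(U.card * w k) := by
  rw [← nsmul_eq_mul, ← Finset.sum_const, ← Finset.sum_congr rfl (hw k)]
  rfl

variable [Fintype V]

theorem schurDensity_reduced (b : {i // i ∉ U} → ℝ) (S : Matrix {i // i ∉ U} {i // i ∉ U} ℝ) :
    (𝒢.reduced U).schurDensity (reducedSplitEquiv U) b S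
      = 𝒢.schurDensity (splitEquiv U) b S := by
  have h : ∑ i, ∑ k, (𝒢.reduced U).weight (reducedSplitEquiv U (.inl i))
        (reducedSplitEquiv U (.inr k))
      = ∑ i, ∑ k, 𝒢.weight (splitEquiv U (.inl i)) (splitEquiv U (.inr k)) := by
    have h1 := crossBlock_splitEquiv hw
    have h2 := crossBlock_reducedSplitEquiv hw
    simp only [crossBlock, of_apply, neg_inj] at h1 h2
    simp only [h1, h2]
    simp [Finset.mul_sum]
  rw [schurDensity, schurDensity, h]
  rfl

variable {a : {i // i ∈ U} → ℝ} (ha : ((𝒢.inside U).schrodinger a).PosDef)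
  (hU : U.Nonempty)

include ha hU

omit [Fintype V] in
theorem schur_reduced (b : {i // i ∉ U} → ℝ) :
    (𝒢.reduced U).schur (reducedSplitEquiv U) (fun _ => 𝒢.reducedPotential U a) b
      = 𝒢.schur (splitEquiv U) a b := by
  have hs := greenSum_inside_pos ha hU
  have hc : (0 : ℝ) < U.card := Nat.cast_pos.2 hU.card_pos
  rw [schur, schur]
  congr 1
  ext k l
  have h1 : ((𝒢.crossBlock (splitEquiv U))ᵀ * (𝒢.inside U).green a
      * 𝒢.crossBlock (splitEquiv U)) k l = w k * w l * (𝒢.inside U).greenSum a := by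
    rw [Matrix.mul_assoc]
    simp only [mul_apply, transpose_apply, crossBlock_splitEquiv hw, greenSum, dotProduct, mulVec,
      Finset.mul_sum]
    refine Finset.sum_congr rfl fun i _ => Finset.sum_congr rfl fun j _ => ?_
    ring
  rw [h1]
  simp only [mul_apply, transpose_apply, crossBlock_reducedSplitEquiv hw, Finset.univ_unique,
    Finset.sum_singleton, PUnit.default_eq_unit, green_unit, reducedPotential]
  field_simp

theorem coarseGrain_green {b : {i // i ∉ U} → ℝ} (hS : (𝒢.schur (splitEquiv U) a b).PosDef) :
    coarseGrain U (𝒢.green (Sum.elim a b ∘ (splitEquiv U).symm))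
      = (𝒢.reduced U).green
        (Sum.elim (fun _ => 𝒢.reducedPotential U a) b ∘ (reducedSplitEquiv U).symm) := by
  have hs := greenSum_inside_pos ha hU
  have hc : (0 : ℝ) < U.card := Nat.cast_pos.2 hU.card_pos
  set n : ℝ := (U.card : ℝ) with hn
  set s := (𝒢.inside U).greenSum a with hsdef
  set e := splitEquiv U
  set e' := reducedSplitEquiv U
  set M := (𝒢.schrodinger (Sum.elim a b ∘ e.symm)).submatrix e e with hM
  set M' := ((𝒢.reduced U).schrodinger
    (Sum.elim (fun _ => 𝒢.reducedPotential U a) b ∘ e'.symm)).submatrix e' e' with hM'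
  let P : Matrix (Unit ⊕ {i // i ∉ U}) ({i // i ∈ U} ⊕ {i // i ∉ U}) ℝ :=
    fromBlocks (of fun _ _ => n⁻¹) 0 0 1
  set q : {i // i ∈ U} → ℝ := fun i => n / s * ((𝒢.inside U).green a *ᵥ fun _ => 1) i with hq
  let Q : Matrix ({i // i ∈ U} ⊕ {i // i ∉ U}) (Unit ⊕ {i // i ∉ U}) ℝ :=
    fromBlocks (of fun i _ => q i) 0 0 1
  have hqsum : ∑ i, q i = n := by
    have : ∑ i, ((𝒢.inside U).green a *ᵥ fun _ => 1) i = s := by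
      simp [hsdef, greenSum, dotProduct]
    rw [hq, ← Finset.mul_sum, this]
    field_simp
  have hqsum' : ∑ i ∈ U.attach, q i = n := hqsum
  have hPQ : P * Q = 1 := by
    rw [fromBlocks_multiply, ← fromBlocks_one]
    congr 1
    · ext i j
      simp [mul_apply, ← Finset.mul_sum, hqsum', hc.ne']
    all_goals simp
  have hAq : (𝒢.inside U).schrodinger a *ᵥ q = fun _ => n / s := by
    have : q = (n / s) • ((𝒢.inside U).green a *ᵥ fun _ => 1) := rfl
    rw [this, mulVec_smul, mulVec_mulVec, green,
      mul_nonsing_inv _ (isUnit_iff_ne_zero.2 ha.det_pos.ne'), one_mulVec]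
    ext i
    simp
  have hMQ : M * Q = Pᵀ * M' := by
    rw [hM, hM', schrodinger_submatrix_eq_fromBlocks, schrodinger_submatrix_eq_fromBlocks,
      fromBlocks_transpose, fromBlocks_multiply, fromBlocks_multiply]
    congr 1
    · ext i j
      have h : ((𝒢.inside U).schrodinger a * of fun i _ => q i) i j = n / s := congrFun hAq i
      rw [Matrix.mul_zero, add_zero]
      refine h.trans ?_
      simp only [mul_apply, of_apply, transpose_apply, Finset.univ_unique, Finset.sum_singleton,
        schrodinger, if_true, reducedPotential, transpose_zero, Matrix.zero_mul, add_zero]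
      rw [← hsdef, ← hn]
      field_simp
    · ext i k
      simp [mul_apply, crossBlock_splitEquiv hw, crossBlock_reducedSplitEquiv hw, e, e', ← hn,
        hc.ne']
    · ext k j
      simp [mul_apply, crossBlock_splitEquiv hw, crossBlock_reducedSplitEquiv hw, e, e', ← hn,
        ← Finset.mul_sum, hqsum', mul_comm]
    · simp
      rfl
  have hMu : IsUnit M.det := by
    rw [hM, det_submatrix_equiv_self]
    exact isUnit_iff_ne_zero.2 ((𝒢.posDef_schrodinger_iff e a b).2 ⟨ha, hS⟩).det_pos.ne'
  have hinv : M'⁻¹ = P * M⁻¹ * Pᵀ := by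
    refine inv_eq_left_inv ?_
    rw [Matrix.mul_assoc, Matrix.mul_assoc, ← hMQ, nonsing_inv_mul_cancel_left _ _ hMu, hPQ]
  have hsub : (coarseGrain U (𝒢.green (Sum.elim a b ∘ e.symm))).submatrix e' e'
      = P * M⁻¹ * Pᵀ := by
    rw [hM, inv_submatrix_equiv]
    change _ = P * (𝒢.green (Sum.elim a b ∘ e.symm)).submatrix e e * Pᵀ
    generalize 𝒢.green (Sum.elim a b ∘ e.symm) = G
    rw [← fromBlocks_toBlocks (G.submatrix e e), fromBlocks_transpose, fromBlocks_multiply,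
      fromBlocks_multiply]
    have hsumU : ∀ f : V → ℝ, ∑ i ∈ U, f i = ∑ i : {i // i ∈ U}, f i := fun f =>
      (Finset.sum_coe_sort U f).symm
    ext (i | k) (j | l)
    · change (n ^ 2)⁻¹ * ∑ i ∈ U, ∑ j ∈ U, G i j = _
      simp only [hsumU]
      simp [mul_apply, Finset.mul_sum, Finset.sum_mul]
      rw [Finset.sum_comm]
      refine Finset.sum_congr rfl fun x _ => Finset.sum_congr rfl fun y _ => ?_
      change _ = n⁻¹ * G y x * n⁻¹
      ring
    · change n⁻¹ * ∑ i ∈ U, G i l = _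
      simp only [hsumU]
      simp [mul_apply, Finset.mul_sum]
      rfl
    · change n⁻¹ * ∑ i ∈ U, G k i = _
      simp only [hsumU]
      simp [mul_apply, Finset.mul_sum]
      refine Finset.sum_congr rfl fun x _ => mul_comm _ _
    · change G k l = _
      simp
      rfl
  have hfin := hsub.trans hinv.symm
  rw [hM', inv_submatrix_equiv] at hfin
  exact (Matrix.reindex e'.symm e'.symm).injective hfin

end Blocks

end

end WeightedGraph

namespace WeightedGraph

noncomputable section

open Matrix

instance instStandardBorelSpaceEntries {m n : Type*} [Countable m] [Countable n] :
    StandardBorelSpace (Matrix m n ℝ) :=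
  inferInstanceAs (StandardBorelSpace (m → n → ℝ))

variable {V : Type*} [Fintype V] [DecidableEq V]

omit [Fintype V] [DecidableEq V] in
theorem measurable_coarseGrain (U : Finset V) : Measurable (coarseGrain U) := by
  have h : ∀ i j, Measurable fun G : Matrix V V ℝ => G i j := fun i j =>
    (measurable_pi_apply j).comp (measurable_pi_apply i)
  refine measurable_pi_lambda _ fun k => measurable_pi_lambda _ fun l => ?_
  rcases k with _ | k <;> rcases l with _ | l
  · exact (Finset.measurable_sum _ fun i _ => Finset.measurable_sum _ fun j _ => h i j).const_mul _
  · exact (Finset.measurable_sum _ fun i _ => h i l).const_mul _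
  · exact (Finset.measurable_sum _ fun i _ => h k i).const_mul _
  · exact h k l

/-- Coarse-graining the Green matrix gives the Green matrix of the reduced graph. -/
theorem map_coarseGrain_greenLaw (𝒢 : WeightedGraph V) {U : Finset V} (hU : U.Nonempty)
    (hind : 𝒢.Indistinguishable U) :
    𝒢.greenLaw.map (coarseGrain U) = (𝒢.reduced U).greenLaw := by
  obtain ⟨w, hw⟩ := hind.exists_weight hU
  have := hU.to_subtype
  refine Measure.ext_of_lintegral _ fun F hF => ?_
  have hm1 : Measurable fun x => F (coarseGrain U (𝒢.green x)) :=
    hF.comp ((measurable_coarseGrain U).comp 𝒢.measurable_green)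
  have hm2 : Measurable fun x => F ((𝒢.reduced U).green x) :=
    hF.comp (𝒢.reduced U).measurable_green
  rw [greenLaw, greenLaw, lintegral_map hF (measurable_coarseGrain U),
    lintegral_map (f := fun G => F (coarseGrain U G)) (hF.comp (measurable_coarseGrain U))
      𝒢.measurable_green,
    lintegral_map hF (𝒢.reduced U).measurable_green, lintegral_potentialLaw _ hm1,
    lintegral_potentialLaw _ hm2]
  set e := splitEquiv U
  set e' := reducedSplitEquiv U
  rw [lintegral_pi_eq_lintegral_prod_of_equiv_sum e, lintegral_pi_eq_lintegral_prod_of_equiv_sum e']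
  set f : (V → ℝ) → ENNReal := fun x =>
    ENNReal.ofReal (𝒢.potentialDensity x) * F (coarseGrain U (𝒢.green x)) with hf
  set f' : (ReducedVertex U → ℝ) → ENNReal := fun x =>
    ENNReal.ofReal ((𝒢.reduced U).potentialDensity x) * F ((𝒢.reduced U).green x) with hf'
  have hfm : Measurable f := 𝒢.measurable_potentialDensity.ennreal_ofReal.mul hm1
  have hfm' : Measurable f' := (𝒢.reduced U).measurable_potentialDensity.ennreal_ofReal.mul hm2
  change ∫⁻ p : ({i // i ∈ U} → ℝ) × ({i // i ∉ U} → ℝ), f (Sum.elim p.1 p.2 ∘ e.symm)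
    = ∫⁻ p : (Unit → ℝ) × ({i // i ∉ U} → ℝ), f' (Sum.elim p.1 p.2 ∘ e'.symm)
  rw [Measure.volume_eq_prod, Measure.volume_eq_prod,
    lintegral_prod_symm' (fun p : ({i // i ∈ U} → ℝ) × ({i // i ∉ U} → ℝ) =>
      f (Sum.elim p.1 p.2 ∘ e.symm)) (hfm.comp (measurable_sumElim_comp_symm e)),
    lintegral_prod_symm' (fun p : (Unit → ℝ) × ({i // i ∉ U} → ℝ) =>
      f' (Sum.elim p.1 p.2 ∘ e'.symm)) (hfm'.comp (measurable_sumElim_comp_symm e'))]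
  refine lintegral_congr fun b => ?_
  set g : ℝ → ENNReal := fun y => f' (Sum.elim (fun _ => y) b ∘ e'.symm) with hg
  have hgm : Measurable g := by
    refine hfm'.comp ((measurable_sumElim_comp_symm e').comp (Measurable.prodMk ?_ ?_))
    · exact measurable_pi_lambda _ fun _ => measurable_id
    · exact measurable_const
  have hunit : ∫⁻ y : Unit → ℝ, f' (Sum.elim y b ∘ e'.symm) = ∫⁻ y, g y :=
    ((volume_preserving_funUnique Unit ℝ).symm.lintegral_comp_emb
      (MeasurableEquiv.measurableEmbedding _) fun y => f' (Sum.elim y b ∘ e'.symm)).symm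
  have hdens : ∀ y : ℝ, (𝒢.reduced U).potentialDensity (Sum.elim (fun _ => y) b ∘ e'.symm)
      = gammaHalfDensity y * (𝒢.reduced U).schurDensity e' b
          ((𝒢.reduced U).schur e' (fun _ => y) b) := fun y => by
    rw [potentialDensity_eq_mul_schurDensity, potentialDensity_unit]
  set Ψ : ℝ → ENNReal := fun y => (ENNReal.ofReal (gammaHalfDensity y))⁻¹ * g y with hΨ
  have hΨm : Measurable Ψ := measurable_gammaHalfDensity.ennreal_ofReal.inv.mul hgm
  have hγpos : ∀ y, 0 < y → 0 < gammaHalfDensity y := fun y hy => by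
    rw [gammaHalfDensity, if_pos hy]; positivity
  have hΨpos : ∀ y, 0 < y → Ψ y = ENNReal.ofReal ((𝒢.reduced U).schurDensity e' b
      ((𝒢.reduced U).schur e' (fun _ => y) b))
      * F ((𝒢.reduced U).green (Sum.elim (fun _ => y) b ∘ e'.symm)) := fun y hy => by
    have h0 : ENNReal.ofReal (gammaHalfDensity y) ≠ 0 := by simpa using hγpos y hy
    rw [hΨ, hg, hf']
    simp only
    rw [hdens, ENNReal.ofReal_mul (gammaHalfDensity_nonneg y), mul_assoc, ← mul_assoc,
      ENNReal.inv_mul_cancel h0 ENNReal.ofReal_ne_top, one_mul]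
  have hR : ∫⁻ y, g y = ∫⁻ y, ENNReal.ofReal (gammaHalfDensity y) * Ψ y := by
    refine lintegral_congr fun y => ?_
    by_cases hy : 0 < y
    · have h0 : ENNReal.ofReal (gammaHalfDensity y) ≠ 0 := by simpa using hγpos y hy
      rw [hΨ]
      simp only
      rw [← mul_assoc, ENNReal.mul_inv_cancel h0 ENNReal.ofReal_ne_top, one_mul]
    · have h0 : gammaHalfDensity y = 0 := by rw [gammaHalfDensity, if_neg hy]
      rw [hg, hf']
      simp only
      rw [hdens, h0]
      simp
  have hcard : (Fintype.card {i // i ∈ U} : ℝ) = U.card := by simp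
  have hlaw := (𝒢.inside U).lintegral_potentialLaw_comp_greenSum hΨm
  rw [hcard] at hlaw
  have hΨr : Measurable fun a => Ψ ((U.card : ℝ) ^ 2 / (2 * (𝒢.inside U).greenSum a)) :=
    hΨm.comp (measurable_const.div ((𝒢.inside U).measurable_greenSum.const_mul 2))
  rw [hunit, hR, ← hlaw, lintegral_potentialLaw _ hΨr]
  refine lintegral_congr fun a => ?_
  change f (Sum.elim a b ∘ e.symm) = _ * Ψ (𝒢.reducedPotential U a)
  by_cases ha : ((𝒢.inside U).schrodinger a).PosDef
  · rw [hΨpos _ (reducedPotential_pos ha hU), schur_reduced hw ha hU, schurDensity_reduced hw, hf]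
    simp only
    rw [potentialDensity_eq_mul_schurDensity,
      ENNReal.ofReal_mul ((𝒢.inside U).potentialDensity_nonneg a), mul_assoc]
    by_cases hS : (𝒢.schur e a b).PosDef
    · rw [coarseGrain_green hw ha hU hS]
    · rw [schurDensity, if_neg hS]
      simp
  · rw [hf]
    simp only
    rw [potentialDensity_eq_mul_schurDensity]
    have h0 : (𝒢.inside U).potentialDensity a = 0 := by rw [potentialDensity, if_neg ha]
    rw [h0]
    simp

end

end WeightedGraph

/-- Every measurable map between standard Borel probability spaces can be inverted by
injecting independent uniform randomness. -/
theorem MeasureTheory.Measure.exists_measurable_lift {X Y : Type*} [MeasurableSpace X]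
    [MeasurableSpace Y] [StandardBorelSpace X] [Nonempty X] [StandardBorelSpace Y]
    (μ : Measure X) [IsProbabilityMeasure μ] {π : X → Y} (hπ : Measurable π) :
    ∃ Φ : Y × unitInterval → X, Measurable Φ ∧
      ((μ.map π).prod volume).map (fun p => (p.1, Φ p)) = μ.map fun x => (π x, x) := by
  set ρ : Measure (Y × X) := μ.map fun x => (π x, x) with hρ
  have hm : Measurable fun x => (π x, x) := hπ.prodMk measurable_id
  have : IsProbabilityMeasure ρ := Measure.isProbabilityMeasure_map hm.aemeasurable
  obtain ⟨φ, hφ, hφκ⟩ := ρ.condKernel.exists_measurable_map_eq_unitInterval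
  refine ⟨Function.uncurry φ, hφ, ?_⟩
  have hfst : ρ.fst = μ.map π := by
    exact Measure.fst_map_prodMk measurable_id
  rw [← ρ.disintegrate ρ.condKernel, hfst]
  have : IsProbabilityMeasure (μ.map π) := Measure.isProbabilityMeasure_map hπ.aemeasurable
  have hm' : Measurable fun p : Y × unitInterval => (p.1, Function.uncurry φ p) :=
    measurable_fst.prodMk hφ
  refine Measure.ext_of_lintegral _ fun F hF => ?_
  rw [lintegral_map hF hm', lintegral_prod
    (fun p : Y × unitInterval => F (p.1, Function.uncurry φ p)) (hF.comp hm').aemeasurable,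
    Measure.lintegral_compProd hF]
  refine lintegral_congr fun y => ?_
  rw [← hφκ]
  exact (lintegral_map (hF.comp measurable_prodMk_left) (hφ.comp measurable_prodMk_left)).symm

theorem mainTheorem7 {V : Type*} [Fintype V] [DecidableEq V]
    (𝒢 : WeightedGraph V) (h𝒢 : 𝒢.toSimpleGraph.Connected)
    (U : Finset V) (hU : U.Nonempty) (hind : 𝒢.Indistinguishable U) :
    ∃ Φ : Matrix (WeightedGraph.ReducedVertex U) (WeightedGraph.ReducedVertex U) ℝ
        × unitInterval → Matrix V V ℝ,
      Measurable Φ ∧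
      ∀ {Ω : Type*} [MeasurableSpace Ω] (P : Measure Ω) [IsProbabilityMeasure P]
        (G' : Ω → Matrix (WeightedGraph.ReducedVertex U) (WeightedGraph.ReducedVertex U) ℝ)
        (ξ : Ω → unitInterval),
        HasLaw G' (𝒢.reduced U).greenLaw P →
        HasLaw ξ volume P →
        IndepFun G' ξ P →
        HasLaw (fun ω => Φ (G' ω, ξ ω)) 𝒢.greenLaw P ∧
        (∀ᵐ ω ∂P, WeightedGraph.coarseGrain U (Φ (G' ω, ξ ω)) = G' ω) ∧
        (∀ᵐ ω ∂P, ∀ (k l : V) (hk : k ∉ U) (hl : l ∉ U),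
          Φ (G' ω, ξ ω) k l = G' ω (some ⟨k, hk⟩) (some ⟨l, hl⟩)) := by
  have hcm := WeightedGraph.measurable_coarseGrain U
  have : Nonempty (Matrix V V ℝ) := ⟨0⟩
  obtain ⟨Φ, hΦ, hlaw⟩ := 𝒢.greenLaw.exists_measurable_lift hcm
  rw [𝒢.map_coarseGrain_greenLaw hU hind] at hlaw
  have hgm : Measurable fun G => (WeightedGraph.coarseGrain U G, G) := hcm.prodMk measurable_id
  refine ⟨Φ, hΦ, fun {Ω} _ P _ G' ξ hG' hξ hindep => ?_⟩
  have hpm : Measurable fun p => (p.1, Φ p) := measurable_fst.prodMk hΦ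
  have hjoint : HasLaw (fun ω => (G' ω, Φ (G' ω, ξ ω)))
      (𝒢.greenLaw.map fun G => (WeightedGraph.coarseGrain U G, G)) P := by
    have h1 : HasLaw (fun p => (p.1, Φ p)) _ ((𝒢.reduced U).greenLaw.prod volume) :=
      ⟨hpm.aemeasurable, hlaw⟩
    exact h1.fun_comp (hindep.hasLaw_prod hG' hξ)
  have hae : ∀ᵐ ω ∂P, WeightedGraph.coarseGrain U (Φ (G' ω, ξ ω)) = G' ω := by
    have hset : MeasurableSet {p : Matrix (WeightedGraph.ReducedVertex U)
        (WeightedGraph.ReducedVertex U) ℝ × Matrix V V ℝ |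
        WeightedGraph.coarseGrain U p.2 = p.1} :=
      measurableSet_eq_fun (hcm.comp measurable_snd) measurable_fst
    refine (hjoint.ae_iff (p := fun p => WeightedGraph.coarseGrain U p.2 = p.1)
      (measurableSet_setOfPred.1 hset)).2 ?_
    rw [ae_map_iff hgm.aemeasurable hset]
    exact ae_of_all _ fun _ => rfl
  refine ⟨?_, hae, ?_⟩
  · have hsnd : HasLaw Prod.snd 𝒢.greenLaw
        (𝒢.greenLaw.map fun G => (WeightedGraph.coarseGrain U G, G)) := by
      refine ⟨measurable_snd.aemeasurable, ?_⟩
      rw [Measure.map_map measurable_snd hgm]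
      exact Measure.map_id
    exact hsnd.fun_comp hjoint
  · filter_upwards [hae] with ω hω k l hk hl
    exact congrFun (congrFun hω (some ⟨k, hk⟩)) (some ⟨l, hl⟩)
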